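/- Let $\lambda_l,\mu>0$ and let $\Phi$ be the Poisson line Cox point process in $\mathbb{R}^2$ with line intensity $\lambda_l$ and point intensity $\mu$, i.e. the point process constructed as follows. Let $\Xi=\{(r_i,\theta_i)\}_{i\in\mathbb{Z}}$ be a Poisson point process on $\mathbb{R}\times[0,\pi)$ with intensity measure $\lambda_l\,\mathrm{d}r\,\frac{\mathrm{d}\theta}{\pi}$, and let each $(r_i,\theta_i)$ determine the line $l(r_i,\theta_i)=\{(x,y)\in\mathbb{R}^2: -x\sin\theta_i+y\cos\theta_i=r_i\}$, which has signed distance $r_i$ from the origin and makes the angle $\theta_i$ with the $x$-axis. Conditionally on these lines, let $\phi_i$, $i\in\mathbb{Z}$, be independent Poisson point processes on the lines $l(r_i,\theta_i)$, each of constant intensity $\mu$ per unit length, and put $\Phi=\sum_{i\in\mathbb{Z}}\phi_i$. Then, with probability one, there is no circle in $\mathbb{R}^2$ that contains four distinct points of $\Phi$. -/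

import Mathlib

open MeasureTheory ProbabilityTheory
open scoped ENNReal NNReal

noncomputable section

/-- The Euclidean plane. -/
abbrev Plane : Type := EuclideanSpace ℝ (Fin 2)

/-- The cylinder `ℝ × [0, π)` of line parameters `(r, θ)`. -/
abbrev Cylinder : Type := ℝ × Set.Ico (0 : ℝ) Real.pi

/-- Arc-length parametrization of the line with parameters `(r, θ)`. The line makes the angle `θ`
with the `x`-axis (counterclockwise) and has signed distance `r` from the origin; the value at
`t = 0` is the foot of the perpendicular from the origin. -/
def linePoint (l : Cylinder) (t : ℝ) : Plane :=
  !₂[-l.1 * Real.sin l.2 + t * Real.cos l.2, l.1 * Real.cos l.2 + t * Real.sin l.2]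

/-- The length measure on the line with parameters `(r, θ)`, as a measure on the plane. -/
def lineLength (l : Cylinder) : Measure Plane :=
  (volume : Measure ℝ).map (linePoint l)

/-- A measure that takes only the values `0, 1, 2, …, ∞`. -/
def IsCountingMeasure {E : Type*} [MeasurableSpace E] (m : Measure E) : Prop :=
  ∀ B : Set E, MeasurableSet B → ∃ n : ℕ∞, m B = (n : ℝ≥0∞)

/-- The points of a counting measure: its atoms. -/
def pointSet {E : Type*} [MeasurableSpace E] (m : Measure E) : Set E :=
  {x | m {x} ≠ 0}

/-- `N` is a Poisson point process with intensity measure `ν` under the probability `P`. -/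
structure IsPoissonPointProcess {Ω E : Type*} [MeasurableSpace Ω] [MeasurableSpace E]
    (P : Measure Ω) (ν : Measure E) (N : Ω → Measure E) : Prop where
  measurable : Measurable N
  counting : ∀ᵐ ω ∂P, IsCountingMeasure (N ω)
  law : ∀ B : Set E, MeasurableSet B → ν B < ∞ →
    ∀ n : ℕ, P {ω | N ω B = (n : ℝ≥0∞)} = poissonMeasure (ν B).toNNReal {n}
  indep : ∀ (k : ℕ) (B : Fin k → Set E), (∀ j, MeasurableSet (B j)) →
    Pairwise (fun j j' => Disjoint (B j) (B j')) → iIndepFun (fun j ω => N ω (B j)) P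

/-- Conditionally on the random element `X`, the `φ i` are independent Poisson point processes,
`φ i` with the (`X`-dependent, finite on bounded sets) intensity measure `ν i`: given `X`, the
numbers `φ (i j) (B j)`, for finitely many bounded sets `B j` such that sets belonging to the same
process are disjoint, are independent Poisson variables with means `ν (i j) (B j)`. -/
structure AreCondIndepPoisson {Ω 𝓧 ι E : Type*} [MeasurableSpace Ω] [MeasurableSpace 𝓧]
    [MetricSpace E] [MeasurableSpace E]
    (P : Measure Ω) (X : Ω → 𝓧) (ν : ι → 𝓧 → Measure E) (φ : ι → Ω → Measure E) : Prop where
  measurable : ∀ i, Measurable (φ i)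
  counting : ∀ i, ∀ᵐ ω ∂P, IsCountingMeasure (φ i ω)
  law : ∀ (k : ℕ) (i : Fin k → ι) (B : Fin k → Set E) (n : Fin k → ℕ),
    (∀ j, MeasurableSet (B j)) → (∀ j, Bornology.IsBounded (B j)) →
    (∀ j j', j ≠ j' → i j = i j' → Disjoint (B j) (B j')) →
    P[({ω | ∀ j, φ (i j) ω (B j) = (n j : ℝ≥0∞)}).indicator (fun _ => (1 : ℝ)) |
        MeasurableSpace.comap X inferInstance]
      =ᵐ[P] fun ω => ∏ j, (poissonMeasure (ν (i j) (X ω) (B j)).toNNReal).real {n j}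

/-- The uniform distribution `dθ / π` on `[0, π)`. -/
def angleLaw : Measure (Set.Ico (0 : ℝ) Real.pi) :=
  (ENNReal.ofReal Real.pi)⁻¹ • (volume : Measure ℝ).comap Subtype.val

/-- `Φ` is a Poisson line Cox point process with line intensity `lam` and point intensity `mu`:
the random lines `L i` are the points of a Poisson point process on `ℝ × [0, π)` with intensity
measure `lam dr dθ / π`; conditionally on the lines, the `φ i` are independent Poisson point
processes on the lines `L i`, with intensity `mu` per unit length; `Φ` is the superposition of
the `φ i`. -/
def IsPoissonLineCoxProcess {Ω : Type*} [MeasurableSpace Ω] (P : Measure Ω) (lam mu : ℝ≥0)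
    (Φ : Ω → Measure Plane) : Prop :=
  ∃ (L : ℤ → Ω → Cylinder) (φ : ℤ → Ω → Measure Plane),
    (∀ i, Measurable (L i)) ∧
    IsPoissonPointProcess P (lam • (volume : Measure ℝ).prod angleLaw)
      (fun ω => Measure.sum fun i => Measure.dirac (L i ω)) ∧
    AreCondIndepPoisson P (fun ω i => L i ω) (fun i l => mu • lineLength (l i)) φ ∧
    ∀ ω, Φ ω = Measure.sum fun i => φ i ω

end

/-! Four distinct points of a circle satisfy `circleDet = 0` and `areaDet ≠ 0`. If the four lines
are fixed (some may coincide), `circleDet` is quadratic in the position of the last point, with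
leading coefficient `areaDet` of the first three. By Fubini, such quadruples are null for the
product of the length measures (`volume_circleDet`).

The null set passes to the point process by a first-moment bound. For disjoint bounded cells, the
probability that all of them are occupied is at most the expected product of the intensities
(`AreCondIndepPoisson.measure_forall_ne_zero_le`). Covering a closed bounded set of separated
quadruples by products of small cells bounds the probability of meeting it by the expected length
measure of a thickening, which shrinks to zero (`measure_exists_mem_eq_zero`). Countably many such
sets and choices of line labels cover all cases. -/

/-! ### Algebra of concyclic points -/

/-- The determinant, linear in each row `(|a|², a₀, a₁)` with `a = x j - x 0`, that vanishes when
the four points lie on a common circle. -/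
noncomputable def circleDet (x : Fin 4 → Plane) : ℝ :=
  ((x 1 0 - x 0 0) ^ 2 + (x 1 1 - x 0 1) ^ 2) *
      ((x 2 0 - x 0 0) * (x 3 1 - x 0 1) - (x 2 1 - x 0 1) * (x 3 0 - x 0 0)) -
    ((x 2 0 - x 0 0) ^ 2 + (x 2 1 - x 0 1) ^ 2) *
      ((x 1 0 - x 0 0) * (x 3 1 - x 0 1) - (x 1 1 - x 0 1) * (x 3 0 - x 0 0)) +
    ((x 3 0 - x 0 0) ^ 2 + (x 3 1 - x 0 1) ^ 2) *
      ((x 1 0 - x 0 0) * (x 2 1 - x 0 1) - (x 1 1 - x 0 1) * (x 2 0 - x 0 0))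

/-- Twice the signed area of the triangle spanned by the first three points. -/
noncomputable def areaDet (x : Fin 4 → Plane) : ℝ :=
  (x 1 0 - x 0 0) * (x 2 1 - x 0 1) - (x 1 1 - x 0 1) * (x 2 0 - x 0 0)

theorem sq_dist_plane (x y : Plane) : dist x y ^ 2 = (x 0 - y 0) ^ 2 + (x 1 - y 1) ^ 2 := by
  rw [EuclideanSpace.dist_eq, Real.sq_sqrt (by positivity)]
  simp [Fin.sum_univ_two, Real.dist_eq, sq_abs]

/-- Subtracting circle equations gives `|a|² = 2⟨a, c - x 0⟩` for each `a = x j - x 0`, so the first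
column of the determinant is a combination of the other two. -/
theorem circleDet_eq_zero {x : Fin 4 → Plane} {c : Plane} {R : ℝ}
    (h : ∀ j, dist (x j) c = R) : circleDet x = 0 := by
  have h' : ∀ j, (x j 0 - c 0) ^ 2 + (x j 1 - c 1) ^ 2 = R ^ 2 := fun j => by
    rw [← sq_dist_plane, h]
  have e : ∀ j, (x j 0 - x 0 0) ^ 2 + (x j 1 - x 0 1) ^ 2 =
      2 * ((x j 0 - x 0 0) * (c 0 - x 0 0) + (x j 1 - x 0 1) * (c 1 - x 0 1)) := fun j => by
    linear_combination h' j - h' 0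
  rw [circleDet, e 1, e 2, e 3]
  ring

/-- A line meets a circle in at most two points. -/
theorem areaDet_ne_zero {x : Fin 4 → Plane} (hx : Function.Injective x) {c : Plane} {R : ℝ}
    (h : ∀ j, dist (x j) c = R) : areaDet x ≠ 0 := by
  have h' : ∀ j, (x j 0 - c 0) ^ 2 + (x j 1 - c 1) ^ 2 = R ^ 2 := fun j => by
    rw [← sq_dist_plane, h]
  have ne : ∀ i j : Fin 4, i ≠ j → (x i 0 - x j 0) ^ 2 + (x i 1 - x j 1) ^ 2 ≠ 0 := by
    intro i j hij
    rw [← sq_dist_plane]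
    exact pow_ne_zero _ (dist_ne_zero.2 (hx.ne hij))
  intro ha
  rw [areaDet] at ha
  have e1 : (x 1 0 - x 0 0) ^ 2 + (x 1 1 - x 0 1) ^ 2 =
      2 * ((x 1 0 - x 0 0) * (c 0 - x 0 0) + (x 1 1 - x 0 1) * (c 1 - x 0 1)) := by
    linear_combination h' 1 - h' 0
  have e2 : (x 2 0 - x 0 0) ^ 2 + (x 2 1 - x 0 1) ^ 2 =
      2 * ((x 2 0 - x 0 0) * (c 0 - x 0 0) + (x 2 1 - x 0 1) * (c 1 - x 0 1)) := by
    linear_combination h' 2 - h' 0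
  have n1 := ne 1 0 (by decide)
  have n2 := ne 2 0 (by decide)
  have n3 := ne 2 1 (by decide)
  have s1 : x 2 0 - x 1 0 = (x 2 0 - x 0 0) - (x 1 0 - x 0 0) := by ring
  have s2 : x 2 1 - x 1 1 = (x 2 1 - x 0 1) - (x 1 1 - x 0 1) := by ring
  rw [s1, s2] at n3
  generalize x 1 0 - x 0 0 = a at *
  generalize x 1 1 - x 0 1 = b at *
  generalize x 2 0 - x 0 0 = p at *
  generalize x 2 1 - x 0 1 = q at *
  generalize c 0 - x 0 0 = u at *
  generalize c 1 - x 0 1 = v at *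
  obtain ⟨s, hp, hq⟩ : ∃ s, p = s * a ∧ q = s * b := by
    -- The coefficient of the orthogonal projection of `(p, q)` onto `(a, b)`.
    refine ⟨(p * a + q * b) / (a ^ 2 + b ^ 2), ?_, ?_⟩
    · field_simp; linear_combination (-b) * ha
    · field_simp; linear_combination a * ha
  subst hp hq
  have : s * (s - 1) * (a ^ 2 + b ^ 2) = 0 := by linear_combination e2 - s * e1
  rcases mul_eq_zero.1 this with h | h
  · rcases mul_eq_zero.1 h with h | h
    · exact n2 (by rw [h]; ring)
    · exact n3 (by rw [show s = 1 by linarith]; ring)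
  · exact n1 h

theorem continuous_circleDet : Continuous circleDet := by unfold circleDet; fun_prop
theorem continuous_areaDet : Continuous areaDet := by unfold areaDet; fun_prop

/-! ### Concyclic quadruples on four fixed lines -/

theorem continuous_linePoint : Continuous fun p : Cylinder × ℝ => linePoint p.1 p.2 := by
  unfold linePoint
  refine (PiLp.continuous_toLp 2 _).comp (continuous_pi fun i => ?_)
  fin_cases i <;> simp <;> fun_prop

theorem norm_sq_linePoint (l : Cylinder) (t : ℝ) : ‖linePoint l t‖ ^ 2 = l.1 ^ 2 + t ^ 2 := by
  rw [EuclideanSpace.norm_eq, Real.sq_sqrt (by positivity)]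
  simp only [Fin.sum_univ_two, Real.norm_eq_abs, sq_abs, linePoint]
  simp
  linear_combination (l.1 ^ 2 + t ^ 2) * Real.sin_sq_add_cos_sq (l.2 : ℝ)

theorem abs_le_norm_linePoint (l : Cylinder) (t : ℝ) : |t| ≤ ‖linePoint l t‖ := by
  refine abs_le_of_sq_le_sq ?_ (norm_nonneg _)
  rw [norm_sq_linePoint]; nlinarith [sq_nonneg l.1]

theorem finite_quadratic {a b c : ℝ} (ha : a ≠ 0) : {t : ℝ | a * t ^ 2 + b * t + c = 0}.Finite := by
  open Polynomial in
  have hp : (C a * X ^ 2 + C b * X + C c : ℝ[X]) ≠ 0 := fun h => by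
    have := congrArg (fun p => Polynomial.coeff p 2) h
    simp at this
    exact ha this
  refine (Polynomial.finite_setOfPred_isRoot hp).subset fun t ht => ?_
  simpa [Polynomial.IsRoot] using ht

/-- The points with parameters `t` on the lines `l`. -/
noncomputable def linePoints {k : ℕ} (l : Fin k → Cylinder) (t : Fin k → ℝ) : Fin k → Plane :=
  fun j => linePoint (l j) (t j)

theorem continuous_linePoints {k : ℕ} :
    Continuous fun p : (Fin k → Cylinder) × (Fin k → ℝ) => linePoints p.1 p.2 := by
  unfold linePoints
  refine continuous_pi fun j => continuous_linePoint.comp (f := fun p : (Fin k → Cylinder) × (Fin k → ℝ) => (p.1 j, p.2 j)) (by fun_prop)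

theorem finite_circleDet (l : Fin 4 → Cylinder) (s : Fin 3 → ℝ) :
    {u : ℝ | areaDet (linePoints l ((Fin.last 3).insertNth u s)) ≠ 0 ∧
      circleDet (linePoints l ((Fin.last 3).insertNth u s)) = 0}.Finite := by
  set y : Fin 4 → Plane := linePoints l ((Fin.last 3).insertNth 0 s) with hy
  have h0 : ∀ u, linePoints l ((Fin.last 3).insertNth u s) 0 = y 0 := fun u => rfl
  have h1 : ∀ u, linePoints l ((Fin.last 3).insertNth u s) 1 = y 1 := fun u => rfl
  have h2 : ∀ u, linePoints l ((Fin.last 3).insertNth u s) 2 = y 2 := fun u => rfl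
  have h3 : ∀ u, linePoints l ((Fin.last 3).insertNth u s) 3 = linePoint (l 3) u := fun u => rfl
  -- `areaDet` involves only the first three points, hence does not depend on `u`.
  by_cases ha : areaDet y = 0
  · refine Set.finite_empty.subset fun u hu => hu.1 ?_
    rwa [areaDet, h0, h1, h2]
  · set p := linePoint (l 3) 0 with hp
    set C := Real.cos (l 3).2 with hC
    set S := Real.sin (l 3).2 with hS
    have q0 : ∀ u, linePoint (l 3) u 0 = p 0 + u * C := fun u => by simp [linePoint, hp, hC]
    have q1 : ∀ u, linePoint (l 3) u 1 = p 1 + u * S := fun u => by simp [linePoint, hp, hS]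
    have hCS : C ^ 2 + S ^ 2 = 1 := Real.cos_sq_add_sin_sq _
    set A := areaDet y with hA
    rw [areaDet] at hA
    let U := (y 1 0 - y 0 0) ^ 2 + (y 1 1 - y 0 1) ^ 2
    let V := (y 2 0 - y 0 0) ^ 2 + (y 2 1 - y 0 1) ^ 2
    refine (finite_quadratic (a := A)
      (b := U * ((y 2 0 - y 0 0) * S - (y 2 1 - y 0 1) * C) -
        V * ((y 1 0 - y 0 0) * S - (y 1 1 - y 0 1) * C) +
        2 * A * ((p 0 - y 0 0) * C + (p 1 - y 0 1) * S))
      (c := U * ((y 2 0 - y 0 0) * (p 1 - y 0 1) - (y 2 1 - y 0 1) * (p 0 - y 0 0)) -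
        V * ((y 1 0 - y 0 0) * (p 1 - y 0 1) - (y 1 1 - y 0 1) * (p 0 - y 0 0)) +
        A * ((p 0 - y 0 0) ^ 2 + (p 1 - y 0 1) ^ 2)) ha).subset fun u hu => ?_
    have h := hu.2
    rw [circleDet, h0, h1, h2, h3, q0, q1, ← hA] at h
    simp only [Set.mem_ofPred_eq, U, V]
    linear_combination h - A * u ^ 2 * hCS

/-- Fubini in the last coordinate: every slice is finite. -/
theorem volume_circleDet (l : Fin 4 → Cylinder) :
    volume {t : Fin 4 → ℝ | areaDet (linePoints l t) ≠ 0 ∧ circleDet (linePoints l t) = 0} = 0 := by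
  have hc : Continuous fun t => linePoints l t :=
    continuous_linePoints.comp (f := fun t => (l, t)) (by fun_prop)
  have hm : MeasurableSet
      {t : Fin 4 → ℝ | areaDet (linePoints l t) ≠ 0 ∧ circleDet (linePoints l t) = 0} :=
    ((isOpen_ne_fun (continuous_areaDet.comp hc) continuous_const).measurableSet).inter
      (isClosed_eq (continuous_circleDet.comp hc) continuous_const).measurableSet
  have hp := (volume_preserving_piFinSuccAbove (fun _ : Fin 4 => ℝ) (Fin.last 3)).symm
  rw [← hp.measure_preimage hm.nullMeasurableSet, Measure.volume_eq_prod,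
    Measure.prod_apply_symm (hp.measurable hm)]
  refine lintegral_eq_zero_of_ae_eq_zero (Filter.Eventually.of_forall fun s => ?_)
  exact (finite_circleDet l s).measure_zero _

/-! ### Occupation probabilities of disjoint cells -/

theorem prod_indicator_one {Ω ι : Type*} (s : Finset ι) (A : ι → Set Ω) (ω : Ω) :
    ∏ j ∈ s, (A j).indicator (fun _ => (1 : ℝ)) ω =
      (⋂ j ∈ s, A j).indicator (fun _ => (1 : ℝ)) ω := by
  by_cases h : ω ∈ ⋂ j ∈ s, A j
  · rw [Set.indicator_of_mem h]
    exact Finset.prod_eq_one fun j hj => Set.indicator_of_mem (Set.mem_iInter₂.1 h j hj) _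
  · rw [Set.indicator_of_notMem h]
    obtain ⟨j, hj, hn⟩ : ∃ j ∈ s, ω ∉ A j := by simpa using h
    exact Finset.prod_eq_zero hj (Set.indicator_of_notMem hn _)

/-- Void probabilities suffice: inclusion-exclusion gives the expectation of `∏ (1 - exp (-ν))`, and
`1 - exp (-a) ≤ a`. -/
theorem AreCondIndepPoisson.measure_forall_ne_zero_le
    {Ω 𝓧 ι E : Type*} [MeasurableSpace Ω] [MeasurableSpace 𝓧] [MetricSpace E] [MeasurableSpace E]
    {P : Measure Ω} [IsProbabilityMeasure P] {X : Ω → 𝓧} {ν : ι → 𝓧 → Measure E}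
    {φ : ι → Ω → Measure E} (h : AreCondIndepPoisson P X ν φ) (hX : Measurable X)
    {k : ℕ} (i : Fin k → ι) (B : Fin k → Set E) (hB : ∀ j, MeasurableSet (B j))
    (hb : ∀ j, Bornology.IsBounded (B j))
    (hd : ∀ j j', j ≠ j' → i j = i j' → Disjoint (B j) (B j')) :
    P {ω | ∀ j, φ (i j) ω (B j) ≠ 0} ≤ ∫⁻ ω, ∏ j, ν (i j) (X ω) (B j) ∂P := by
  classical
  have hmφ : ∀ j, Measurable fun ω => φ (i j) ω (B j) := fun j =>
    (Measure.measurable_coe (hB j)).comp (h.measurable (i j))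
  set e : Fin k → Ω → ℝ := fun j ω =>
    Real.exp (-((ν (i j) (X ω) (B j)).toNNReal : ℝ)) with he
  set A : Fin k → Set Ω := fun j => {ω | φ (i j) ω (B j) = 0} with hA
  have hAm : ∀ j, MeasurableSet (A j) := fun j => hmφ j (measurableSet_singleton 0)
  have key : ∀ s : Finset (Fin k), Integrable (fun ω => ∏ j ∈ s, e j ω) P ∧
      ∫ ω, ∏ j ∈ s, e j ω ∂P = ∫ ω, ∏ j ∈ s, (A j).indicator (fun _ => (1 : ℝ)) ω ∂P := by
    intro s
    -- Emptying the cells outside `s` turns their factors into `1`.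
    have hl := h.law k i (fun j => if j ∈ s then B j else ∅) (fun _ => 0)
      (fun j => by split_ifs; exacts [hB j, MeasurableSet.empty])
      (fun j => by split_ifs; exacts [hb j, Bornology.isBounded_empty])
      (fun j j' hj hi => by split_ifs <;> simp [hd j j' hj hi])
    have e1 : (fun ω => ∏ j, (poissonMeasure (ν (i j) (X ω)
        (if j ∈ s then B j else ∅)).toNNReal).real {0}) = fun ω => ∏ j ∈ s, e j ω := by
      funext ω
      rw [← Finset.prod_subset (Finset.subset_univ s)]
      · refine Finset.prod_congr rfl fun j hj => ?_
        simp [poissonMeasure_real_singleton, hj, he]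
      · intro j _ hj
        simp [poissonMeasure_real_singleton, hj]
    have e2 : ({ω | ∀ j, φ (i j) ω (if j ∈ s then B j else ∅) = ((0 : ℕ) : ℝ≥0∞)}).indicator
        (fun _ => (1 : ℝ)) = fun ω => ∏ j ∈ s, (A j).indicator (fun _ => (1 : ℝ)) ω := by
      simp_rw [prod_indicator_one]
      congr 1
      ext ω
      simp only [Set.mem_ofPred_eq, Set.mem_iInter, Nat.cast_zero, hA]
      refine forall_congr' fun j => ?_
      by_cases hj : j ∈ s <;> simp [hj]
    rw [e1, e2] at hl
    refine ⟨integrable_condExp.congr hl, ?_⟩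
    rw [← integral_congr_ae hl, integral_condExp hX.comap_le]
  -- Used twice, for the void probabilities and for the void indicators, whose products have equal
  -- expectations by `key`.
  have hsub : ∀ (f : Fin k → Ω → ℝ), (∀ s : Finset (Fin k), Integrable (fun ω => ∏ j ∈ s, f j ω) P) →
      Integrable (fun ω => ∏ j, (1 - f j ω)) P ∧
      ∫ ω, ∏ j, (1 - f j ω) ∂P =
        ∑ s ∈ Finset.univ.powerset, (-1) ^ s.card * ∫ ω, ∏ j ∈ s, f j ω ∂P := by
    intro f hf
    have e : (fun ω => ∏ j, (1 - f j ω)) =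
        fun ω => ∑ s ∈ Finset.univ.powerset, (-1) ^ s.card * ∏ j ∈ s, f j ω := by
      funext ω
      simp_rw [sub_eq_add_neg, Finset.prod_one_add, Finset.prod_neg]
    rw [e]
    refine ⟨integrable_finsetSum _ fun s _ => (hf s).const_mul _, ?_⟩
    rw [integral_finsetSum _ fun s _ => (hf s).const_mul _]
    simp_rw [integral_const_mul]
  have hAi : ∀ s : Finset (Fin k),
      Integrable (fun ω => ∏ j ∈ s, (A j).indicator (fun _ => (1 : ℝ)) ω) P := by
    intro s
    simp_rw [prod_indicator_one]
    exact (integrable_const _).indicator (Finset.measurableSet_biInter s fun j _ => hAm j)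
  obtain ⟨i1, i2⟩ := hsub e fun s => (key s).1
  obtain ⟨i3, i4⟩ := hsub _ hAi
  have hEm : MeasurableSet {ω | ∀ j, φ (i j) ω (B j) ≠ 0} := by
    simp only [Set.ofPred_forall]
    exact MeasurableSet.iInter fun j => (hAm j).compl
  have hP : P.real {ω | ∀ j, φ (i j) ω (B j) ≠ 0} = ∫ ω, ∏ j, (1 - e j ω) ∂P := by
    rw [i2]
    simp_rw [fun s => (key s).2]
    rw [← i4, ← integral_indicator_one hEm]
    congr 1
    funext ω
    have : ∀ j, 1 - (A j).indicator (fun _ => (1 : ℝ)) ω =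
        (A j)ᶜ.indicator (fun _ => (1 : ℝ)) ω := fun j => by
      rw [Set.indicator_compl]; rfl
    simp_rw [this, prod_indicator_one]
    refine congrFun (congrArg₂ _ ?_ rfl) ω
    ext ω
    simp [hA]
  have hnn : ∀ j ω, 0 ≤ 1 - e j ω := fun j ω =>
    sub_nonneg.2 (Real.exp_le_one_iff.2 (neg_nonpos.2 NNReal.zero_le_coe))
  rw [← ofReal_measureReal, hP, ofReal_integral_eq_lintegral_ofReal i1
    (Filter.Eventually.of_forall fun ω => Finset.prod_nonneg fun j _ => hnn j ω)]
  refine lintegral_mono fun ω => ?_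
  rw [ENNReal.ofReal_prod_of_nonneg fun j _ => hnn j ω]
  refine Finset.prod_le_prod' fun j _ => ?_
  -- An infinite intensity is truncated to `0` by `toNNReal`, which keeps the inequality.
  refine le_trans ?_ (ENNReal.coe_toNNReal_le_self (a := ν (i j) (X ω) (B j)))
  rw [← ENNReal.ofReal_coe_nnreal]
  refine ENNReal.ofReal_le_ofReal ?_
  have := Real.add_one_le_exp (-((ν (i j) (X ω) (B j)).toNNReal : ℝ))
  simp only [he]
  linarith

/-! ### Product of the length measures -/

theorem measurable_linePoints {k : ℕ} (l : Fin k → Cylinder) : Measurable (linePoints l) :=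
  (continuous_linePoints.comp (f := fun t => (l, t)) (by fun_prop)).measurable

/-- The product of the length measures on the lines `l`. -/
noncomputable def linesLength {k : ℕ} (l : Fin k → Cylinder) : Measure (Fin k → Plane) :=
  volume.map (linePoints l)

theorem linesLength_pi {k : ℕ} (l : Fin k → Cylinder) {B : Fin k → Set Plane}
    (hB : ∀ j, MeasurableSet (B j)) :
    linesLength l (Set.univ.pi B) = ∏ j, lineLength (l j) (B j) := by
  have hl : ∀ j, Measurable (linePoint (l j)) := fun j =>
    (continuous_linePoint.comp (f := fun t => (l j, t)) (by fun_prop)).measurable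
  rw [linesLength, Measure.map_apply (measurable_linePoints l)
    (MeasurableSet.pi Set.countable_univ fun j _ => hB j)]
  have : linePoints l ⁻¹' Set.univ.pi B = Set.univ.pi fun j => linePoint (l j) ⁻¹' B j := by
    ext t; simp [linePoints]
  rw [this, volume_pi_pi]
  exact Finset.prod_congr rfl fun j _ => (Measure.map_apply (hl j) (hB j)).symm

/-- The bound is uniform in the lines, so it can serve as a dominating constant. -/
theorem linesLength_le {k : ℕ} (l : Fin k → Cylinder) {S : Set (Fin k → Plane)}
    (hS : MeasurableSet S) {M : ℝ} (hM : ∀ x ∈ S, ∀ j, ‖x j‖ ≤ M) :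
    linesLength l S ≤ ENNReal.ofReal (M - -M) ^ k := by
  rw [linesLength, Measure.map_apply (measurable_linePoints l) hS]
  calc volume (linePoints l ⁻¹' S)
      ≤ volume (Set.univ.pi fun _ : Fin k => Set.Icc (-M) M) :=
        measure_mono fun t ht j _ => abs_le.1 ((abs_le_norm_linePoint (l j) (t j)).trans (hM _ ht j))
    _ = _ := by rw [volume_pi_pi]; simp only [Real.volume_Icc, Finset.prod_const, Finset.card_univ, Fintype.card_fin]

theorem measurable_linesLength {k : ℕ} {S : Set (Fin k → Plane)} (hS : MeasurableSet S) :
    Measurable fun l : Fin k → Cylinder => linesLength l S := by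
  have : (fun l : Fin k → Cylinder => linesLength l S) = fun l => volume (Prod.mk l ⁻¹'
      ((fun p : (Fin k → Cylinder) × (Fin k → ℝ) => linePoints p.1 p.2) ⁻¹' S)) := by
    funext l
    rw [linesLength, Measure.map_apply (measurable_linePoints l) hS]
    rfl
  rw [this]
  exact measurable_measure_prodMk_left (continuous_linePoints.measurable hS)

/-! ### Covering by grid cells -/

/-- The index of the square of side `1 / (n + 1)` that contains `x`. -/
noncomputable def gridIndex (n : ℕ) (x : Plane) : Fin 2 → ℤ := fun a => ⌊(n + 1) * x a⌋

theorem measurable_gridIndex (n : ℕ) : Measurable (gridIndex n) :=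
  measurable_pi_lambda _ fun a => Int.measurable_floor.comp
    ((by fun_prop : Continuous fun x : Plane => (n + 1) * x a).measurable)

/-- The diagonal `√2 / (n + 1)` is rounded up. -/
theorem dist_le_of_gridIndex_eq {n : ℕ} {x y : Plane} (h : gridIndex n x = gridIndex n y) :
    dist x y ≤ 2 / (n + 1) := by
  have hn : (0 : ℝ) < n + 1 := by positivity
  have hc : ∀ a, (x a - y a) ^ 2 ≤ (1 / (n + 1)) ^ 2 := fun a => by
    have := Int.abs_sub_lt_one_of_floor_eq_floor (congrFun h a)
    rw [← mul_sub, abs_mul, abs_of_pos hn, mul_comm, ← lt_div_iff₀ hn] at this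
    rw [← sq_abs]
    exact pow_le_pow_left₀ (abs_nonneg _) this.le 2
  refine abs_le_of_sq_le_sq' ?_ (by positivity) |>.2
  rw [sq_dist_plane]
  have e : (2 / ((n : ℝ) + 1)) ^ 2 = 4 * (1 / (n + 1)) ^ 2 := by ring
  rw [e]
  nlinarith [hc 0, hc 1, sq_nonneg (1 / ((n : ℝ) + 1))]

theorem measure_exists_mem_le {Ω : Type*} [MeasurableSpace Ω] {P : Measure Ω}
    [IsProbabilityMeasure P] {mu : ℝ≥0} {L : ℤ → Ω → Cylinder} {φ : ℤ → Ω → Measure Plane}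
    (hL : ∀ i, Measurable (L i))
    (hφ : AreCondIndepPoisson P (fun ω i => L i ω) (fun i l => mu • lineLength (l i)) φ)
    {k : ℕ} (i : Fin k → ℤ) {K : Set (Fin k → Plane)} {n : ℕ}
    (hK : ∀ x ∈ K, ∀ j j', j ≠ j' → 2 / ((n : ℝ) + 1) < dist (x j) (x j')) :
    P {ω | ∃ x ∈ K, ∀ j, φ (i j) ω {x j} ≠ 0} ≤
      mu ^ k * ∫⁻ ω, linesLength (fun j => L (i j) ω) (Metric.cthickening (2 / (n + 1)) K) ∂P := by
  set G : (Fin k → Fin 2 → ℤ) → Set (Fin k → Plane) := fun q =>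
    Set.univ.pi fun j => gridIndex n ⁻¹' {q j} with hG
  have hcm : ∀ q : Fin 2 → ℤ, MeasurableSet (gridIndex n ⁻¹' {q}) := fun q =>
    measurable_gridIndex n (measurableSet_singleton q)
  have hGm : ∀ q, MeasurableSet (G q) := fun q =>
    MeasurableSet.pi Set.countable_univ fun j _ => hcm _
  set T : Set (Fin k → Fin 2 → ℤ) := {q | ∃ x ∈ K, x ∈ G q} with hT
  -- Points farther apart than a cell diameter lie in distinct, hence disjoint, cells; this permits
  -- repeated labels `i j`.
  have hTinj : ∀ q ∈ T, Function.Injective q := by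
    rintro q ⟨x, hx, hxq⟩ j j' hjj
    by_contra hne
    refine (hK x hx j j' hne).not_ge (dist_le_of_gridIndex_eq ?_)
    rw [hxq j trivial, hxq j' trivial, hjj]
  have hLi : Measurable fun ω => fun j => L (i j) ω := measurable_pi_lambda _ fun j => hL (i j)
  calc P {ω | ∃ x ∈ K, ∀ j, φ (i j) ω {x j} ≠ 0}
      ≤ P (⋃ q : T, {ω | ∀ j, φ (i j) ω (gridIndex n ⁻¹' {q.1 j}) ≠ 0}) := by
        refine measure_mono ?_
        rintro ω ⟨x, hx, h⟩
        refine Set.mem_iUnion.2 ⟨⟨fun j => gridIndex n (x j), x, hx, fun j _ => rfl⟩, fun j h0 => ?_⟩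
        refine h j (measure_mono_null (Set.singleton_subset_iff.2 ?_) h0)
        exact Set.mem_preimage.2 rfl
    _ ≤ ∑' q : T, P {ω | ∀ j, φ (i j) ω (gridIndex n ⁻¹' {q.1 j}) ≠ 0} := measure_iUnion_le _
    _ ≤ ∑' q : T, ∫⁻ ω, mu ^ k * linesLength (fun j => L (i j) ω) (G q.1) ∂P := by
        refine ENNReal.tsum_le_tsum fun q => ?_
        refine (hφ.measure_forall_ne_zero_le (measurable_pi_lambda _ hL) i _ (fun j => hcm _)
          (fun j => ?_) fun j j' hj _ => ?_).trans_eq (lintegral_congr fun ω => ?_)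
        · exact Metric.isBounded_iff.2 ⟨2 / (n + 1), fun x hx y hy =>
            dist_le_of_gridIndex_eq (hx.trans hy.symm)⟩
        · exact Disjoint.preimage _ (Set.disjoint_singleton.2 ((hTinj q.1 q.2).ne hj))
        · rw [hG, linesLength_pi _ fun j => hcm _]
          refine (Finset.prod_congr rfl fun j _ => Measure.nnreal_smul_coe_apply mu _ _).trans ?_
          rw [Finset.prod_mul_distrib, Finset.prod_const, Finset.card_univ, Fintype.card_fin]
    _ = mu ^ k * ∫⁻ ω, ∑' q : T, linesLength (fun j => L (i j) ω) (G q.1) ∂P := by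
        have hm : ∀ q, Measurable fun ω => linesLength (fun j => L (i j) ω) (G q) := fun q =>
          (measurable_linesLength (hGm q)).comp hLi
        rw [lintegral_tsum fun q => (hm _).aemeasurable, ← ENNReal.tsum_mul_left]
        exact tsum_congr fun q => lintegral_const_mul _ (hm _)
    _ ≤ _ := by
        gcongr with ω
        -- The products of cells are disjoint, and those meeting `K` lie in its thickening.
        rw [← measure_iUnion (f := fun q : T => G q.1) _ fun q => hGm q.1]
        · refine measure_mono (Set.iUnion_subset ?_)
          rintro ⟨q, x, hx, hxq⟩ y hy
          refine Metric.mem_cthickening_of_dist_le y x _ _ hx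
            ((dist_pi_le_iff (by positivity)).2 fun j => dist_le_of_gridIndex_eq ?_)
          rw [hxq j trivial, hy j trivial]
        · intro q q' hqq
          refine Set.disjoint_left.2 fun x hx hx' => hqq (Subtype.ext (funext fun j => ?_))
          exact (hx j trivial).symm.trans (hx' j trivial)

/-- The thickenings of a closed set decrease to the set, so their measures tend to zero for each
choice of lines; dominated convergence carries this to the expectation. -/
theorem measure_exists_mem_eq_zero {Ω : Type*} [MeasurableSpace Ω] {P : Measure Ω}
    [IsProbabilityMeasure P] {mu : ℝ≥0} {L : ℤ → Ω → Cylinder} {φ : ℤ → Ω → Measure Plane}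
    (hL : ∀ i, Measurable (L i))
    (hφ : AreCondIndepPoisson P (fun ω i => L i ω) (fun i l => mu • lineLength (l i)) φ)
    {k : ℕ} (i : Fin k → ℤ) {K : Set (Fin k → Plane)} (hKc : IsClosed K) {M δ : ℝ} (hδ : 0 < δ)
    (hM : ∀ x ∈ K, ∀ j, ‖x j‖ ≤ M)
    (hK : ∀ x ∈ K, ∀ j j', j ≠ j' → δ ≤ dist (x j) (x j'))
    (hnull : ∀ l, linesLength l K = 0) :
    P {ω | ∃ x ∈ K, ∀ j, φ (i j) ω {x j} ≠ 0} = 0 := by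
  set r : ℕ → ℝ := fun n => 2 / (n + 1) with hr
  have hr0 : Filter.Tendsto r Filter.atTop (nhds 0) :=
    tendsto_const_div_atTop_nhds_zero_nat 2 |>.comp (Filter.tendsto_add_atTop_nat 1) |>.congr
      fun n => by simp [hr]
  -- The radius `2` is `r 0`, the largest one; `3` leaves room for an open thickening.
  have hM' : ∀ x ∈ Metric.cthickening 2 K, ∀ j, ‖x j‖ ≤ M + 3 := by
    intro x hx j
    obtain ⟨y, hy, hxy⟩ := Metric.mem_thickening_iff.1
      (Metric.cthickening_subset_thickening' (by norm_num) (by norm_num : (2 : ℝ) < 3) K hx)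
    have h1 := (dist_le_pi_dist x y j).trans hxy.le
    have h2 := hM y hy j
    have h3 := norm_le_norm_add_norm_sub' (x j) (y j)
    rw [← dist_eq_norm] at h3
    linarith
  have hr2 : ∀ n, r n ≤ 2 := fun n => by
    rw [hr]; exact div_le_self (by norm_num) (by linarith [n.cast_nonneg (α := ℝ)])
  have hbd : ∀ l n, linesLength l (Metric.cthickening (r n) K) ≤
      ENNReal.ofReal (M + 3 - -(M + 3)) ^ k := fun l n =>
    linesLength_le l Metric.isClosed_cthickening.measurableSet fun x hx =>
      hM' x (Metric.cthickening_mono (hr2 n) K hx)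
  have hlim : ∀ l, Filter.Tendsto (fun n => linesLength l (Metric.cthickening (r n) K))
      Filter.atTop (nhds 0) := by
    intro l
    have := tendsto_measure_cthickening_of_isClosed (μ := linesLength l) (s := K)
      ⟨r 0, by simp [hr], ((hbd l 0).trans_lt (by finiteness)).ne⟩ hKc
    rw [hnull] at this
    exact this.comp hr0
  have hLi : Measurable fun ω => fun j => L (i j) ω := measurable_pi_lambda _ fun j => hL (i j)
  have hint : Filter.Tendsto (fun n => ∫⁻ ω, linesLength (fun j => L (i j) ω)
      (Metric.cthickening (r n) K) ∂P) Filter.atTop (nhds 0) := by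
    rw [← lintegral_zero (μ := P)]
    refine tendsto_lintegral_of_dominated_convergence
      (fun _ => ENNReal.ofReal (M + 3 - -(M + 3)) ^ k) (fun n => ?_)
      (fun n => Filter.Eventually.of_forall fun ω => hbd _ n) (by simp)
      (Filter.Eventually.of_forall fun ω => hlim _)
    exact (measurable_linesLength Metric.isClosed_cthickening.measurableSet).comp hLi
  have hint' := ENNReal.Tendsto.const_mul (a := (mu : ℝ≥0∞) ^ k) hint
    (Or.inr (by finiteness))
  rw [mul_zero] at hint'
  refine le_antisymm (ge_of_tendsto hint' ?_) zero_le
  filter_upwards [hr0.eventually_lt_const hδ] with n hn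
  exact measure_exists_mem_le hL hφ i fun x hx j j' hj => hn.trans_le (hK x hx j j' hj)

/-! ### Exhaustion by closed sets and conclusion -/

/-- Bounded quadruples of separated points whose first three points span a triangle and whose
points satisfy the equation for lying on a common circle. -/
def cocircularSet (m : ℕ) : Set (Fin 4 → Plane) :=
  {x | (∀ j, ‖x j‖ ≤ m) ∧ (∀ j j', j ≠ j' → 1 / ((m : ℝ) + 1) ≤ dist (x j) (x j')) ∧
    1 / ((m : ℝ) + 1) ≤ |areaDet x| ∧ circleDet x = 0}

theorem isClosed_cocircularSet (m : ℕ) : IsClosed (cocircularSet m) := by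
  simp only [cocircularSet, Set.ofPred_and, Set.ofPred_forall]
  have := continuous_areaDet
  have := continuous_circleDet
  refine (isClosed_iInter fun j => isClosed_le (by fun_prop) (by fun_prop)).inter
    ((isClosed_iInter fun j => isClosed_iInter fun j' => isClosed_iInter fun _ =>
      isClosed_le (by fun_prop) (by fun_prop)).inter
    ((isClosed_le (by fun_prop) (by fun_prop)).inter (isClosed_eq (by fun_prop) (by fun_prop))))

theorem linesLength_cocircularSet (m : ℕ) (l : Fin 4 → Cylinder) :
    linesLength l (cocircularSet m) = 0 := by
  rw [linesLength, Measure.map_apply (measurable_linePoints l)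
    (isClosed_cocircularSet m).measurableSet]
  refine measure_mono_null ?_ (volume_circleDet l)
  rintro t ⟨-, -, h, h'⟩
  exact ⟨abs_pos.1 (lt_of_lt_of_le (by positivity) h), h'⟩

theorem exists_mem_cocircularSet {x : Fin 4 → Plane} (hx : Function.Injective x) {c : Plane} {R : ℝ}
    (h : ∀ j, dist (x j) c = R) : ∃ m, x ∈ cocircularSet m := by
  have ev : ∀ a : ℝ, 0 < a → ∀ᶠ m : ℕ in Filter.atTop, 1 / ((m : ℝ) + 1) ≤ a := fun a ha =>
    tendsto_one_div_add_atTop_nhds_zero_nat.eventually_le_const ha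
  have h1 : ∀ᶠ m : ℕ in Filter.atTop, ∀ j, ‖x j‖ ≤ m := Filter.eventually_all.2 fun j =>
    tendsto_natCast_atTop_atTop.eventually_ge_atTop _
  have h2 : ∀ᶠ m : ℕ in Filter.atTop, ∀ j j', j ≠ j' → 1 / ((m : ℝ) + 1) ≤ dist (x j) (x j') := by
    refine Filter.eventually_all.2 fun j => Filter.eventually_all.2 fun j' => ?_
    by_cases hj : j = j'
    · simp [hj]
    · filter_upwards [ev _ (dist_pos.2 (hx.ne hj))] with m hm _ using hm
  obtain ⟨m, a, b, d⟩ := (h1.and (h2.and (ev _ (abs_pos.2 (areaDet_ne_zero hx h))))).exists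
  exact ⟨m, a, b, d, circleDet_eq_zero h⟩

theorem lemma3 {Ω : Type*} [MeasurableSpace Ω] (P : Measure Ω) [IsProbabilityMeasure P]
    (lam mu : ℝ≥0) (hlam : 0 < lam) (hmu : 0 < mu)
    (Φ : Ω → Measure Plane) (hΦ : IsPoissonLineCoxProcess P lam mu Φ) :
    ∀ᵐ ω ∂P, ¬ ∃ x : Fin 4 → Plane, Function.Injective x ∧
      (∀ j, x j ∈ pointSet (Φ ω)) ∧
      ∃ (c : Plane) (R : ℝ), 0 < R ∧ ∀ j, dist (x j) c = R := by
  obtain ⟨L, φ, hL, -, hφ, hsum⟩ := hΦ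
  have key : ∀ᵐ ω ∂P, ∀ (i : Fin 4 → ℤ) (m : ℕ),
      ¬ ∃ x ∈ cocircularSet m, ∀ j, φ (i j) ω {x j} ≠ 0 := by
    refine ae_all_iff.2 fun i => ae_all_iff.2 fun m => ?_
    rw [ae_iff]
    simp only [not_not]
    exact measure_exists_mem_eq_zero hL hφ i (isClosed_cocircularSet m)
      (by positivity : 0 < 1 / ((m : ℝ) + 1)) (fun x hx => hx.1) (fun x hx => hx.2.1)
      (linesLength_cocircularSet m)
  filter_upwards [key] with ω hω
  rintro ⟨x, hx, hxΦ, c, R, -, hR⟩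
  -- An atom of the superposition is an atom of some summand.
  have hi : ∀ j, ∃ i, φ i ω {x j} ≠ 0 := fun j => by
    have h : Φ ω {x j} ≠ 0 := hxΦ j
    rw [hsum, Measure.sum_apply _ (measurableSet_singleton _)] at h
    by_contra! h'
    exact h (ENNReal.tsum_eq_zero.2 h')
  choose i hi using hi
  obtain ⟨m, hm⟩ := exists_mem_cocircularSet hx hR
  exact hω i m ⟨x, hm, hi⟩
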